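/- Let $G$ be a compact (Hausdorff) topological group. For a closed subgroup $H\le G$ let $Pr(H,G)$ denote the probability that a random element of $H$ commutes with a random element of $G$, that is, the measure of the closed set $\{(h,g)\in H\times G : hg=gh\}$ with respect to the normalized Haar measure of the compact group $H\times G$ (the product of the normalized Haar measures of $H$ and $G$). For $x\in G$ let $\langle x\rangle$ denote the monothetic subgroup generated by $x$, i.e. the closure of the abstract cyclic subgroup generated by $x$. (1) Let $K$ be a closed subgroup of $G$. Then $Pr(\langle x\rangle,G)>0$ for every $x\in K$ if and only if $G$ has an open normal subgroup $T$ such that $K/C_K(T)$ is torsion, i.e. every element of $K/C_K(T)$ has finite order. (2) In particular, $Pr(\langle x\rangle,G)>0$ for every $x\in G$ if and only if $G$ is virtually central-by-torsion, that is, $G$ has an open normal subgroup $T$ such that $G/Z(T)$ is torsion. -/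

import Mathlib

open MeasureTheory TopologicalSpace
open scoped ENNReal

namespace CompactGroupPr

/-- The normalized Haar measure of a compact group, on its Borel `σ`-algebra. -/
noncomputable def normalizedHaar (G : Type*) [Group G] [TopologicalSpace G]
    [IsTopologicalGroup G] [CompactSpace G] : @Measure G (borel G) :=
  letI : MeasurableSpace G := borel G
  haveI : BorelSpace G := ⟨rfl⟩
  Measure.haarMeasure (⊤ : PositiveCompacts G)

variable {G : Type*} [Group G] [TopologicalSpace G]

/-- `Pr(H, G)`: the probability that a random element of the compact subgroup `H` commutes with a
random element of `G`. The commuting pairs form a closed subset of the compact group `H × G`, and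
the probability is its measure under the normalized Haar measure of `H × G`, i.e. the (Radon)
product of the normalized Haar measures of `H` and `G`. Taking the Haar measure on the Borel sets of
`H × G` makes this set measurable also when `G` is not second countable. -/
noncomputable def commutingPr [IsTopologicalGroup G] [CompactSpace G] (H : Subgroup G)
    [CompactSpace H] : ℝ≥0∞ :=
  normalizedHaar (H × G) {p : H × G | (p.1 : G) * p.2 = p.2 * (p.1 : G)}

/-- The monothetic subgroup of `G` topologically generated by `x`. -/
def monothetic [IsTopologicalGroup G] (x : G) : Subgroup G :=
  (Subgroup.zpowers x).topologicalClosure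

instance [IsTopologicalGroup G] [CompactSpace G] (x : G) : CompactSpace (monothetic x) :=
  isCompact_iff_compactSpace.mp
    (Subgroup.isClosed_topologicalClosure (Subgroup.zpowers x)).isCompact

/-- `C_K(T)`, as a subgroup of `K`. -/
def centralizerIn (K T : Subgroup G) : Subgroup K :=
  (Subgroup.centralizer (T : Set G)).subgroupOf K

instance (K T : Subgroup G) [T.Normal] : (centralizerIn K T).Normal := by
  unfold centralizerIn; infer_instance

/-- `Z(T)`, as a subgroup of `G`. -/
def centerOf (T : Subgroup G) : Subgroup G :=
  (Subgroup.center T).map T.subtype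

instance (T : Subgroup G) [T.Normal] : (centerOf T).Normal := by
  unfold centerOf; infer_instance

/-- `G` is virtually central-by-torsion: `G / Z(T)` is torsion for some open normal `T`. -/
def IsVirtuallyCentralByTorsion (G : Type*) [Group G] [TopologicalSpace G] : Prop :=
  ∃ (T : Subgroup G) (_ : T.Normal), IsOpen (T : Set G) ∧ IsMulTorsion (G ⧸ centerOf T)

end CompactGroupPr

/-!
If commuting pairs have positive measure in `H × G`, then for `h` near `1` the set of commuting
pairs meets its translate by `(h, 1)` in positive measure, and every `(a, g)` in this intersection
satisfies `hg = gh`; so `C(h)` is open. For a monothetic `H` this makes positivity of `Pr(⟨x⟩, G)`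
equivalent to some `C(x ^ n)`, `n > 0`, having finite index.

Let `D(x)` be the union of the `C(x ^ n)` over `n > 0`, a subgroup equal to one of the `C(x ^ n)`
as soon as one of them has finite index; moreover `D(x) ∩ D(y) ≤ D(xy)` when `x` and `y` commute.
By Baire category the index of `D` is bounded on a nonempty open subset `U` of `K`. Choose `u ∈ U`
maximizing it. If `c ∈ K` commutes with `u`, then `u c ^ i ∈ U` for infinitely many `i`, all
`D(u c ^ i)` contain `D(u) ∩ D(c)`, and two of them agree, whence `D(u c ^ i) ≤ D(u) ∩ D(c)`;
maximality gives `D(u) ≤ D(c)`. To remove the condition that `u` and `c` commute, this is applied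
to `K ∩ C(s)`, where `s` is a maximal set of pairwise commuting elements `c ∈ K` with
`D(c) = C(c)`: every `x ∈ K` has a positive power in `s`, so `D(u) ≤ D(x)` for all `x ∈ K`, and the
normal core of `D(u)` is the required `T`.
-/

namespace CompactGroupPr

open Filter Function Topology Pointwise
open Subgroup (centralizer mem_centralizer_iff mem_centralizer_singleton_iff)

section PowCentralizer

variable {G : Type*} [Group G]

theorem finite_setOf_subgroup_ge (S : Subgroup G) [S.FiniteIndex] : {T | S ≤ T}.Finite := by
  have : Finite {T // S.normalCore ≤ T} :=
    .of_equiv _ (QuotientGroup.comapMk'OrderIso S.normalCore).toEquiv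
  have hcore : {T | S.normalCore ≤ T}.Finite := Set.finite_coe_iff.mp this
  exact hcore.subset fun T hT ↦ S.normalCore_le.trans hT

theorem centralizer_le_centralizer_pow (x : G) (n : ℕ) : centralizer {x} ≤ centralizer {x ^ n} := by
  simp only [SetLike.le_def, mem_centralizer_singleton_iff]
  exact fun g (hg : Commute g x) ↦ hg.pow_right n

/-- The subgroup of all elements that commute with some positive power of `x`: the increasing union,
along divisibility, of the centralizers of the powers of `x`. -/
def powCentralizer (x : G) : Subgroup G where
  carrier := {g | ∃ n, 0 < n ∧ g ∈ centralizer {x ^ n}}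
  one_mem' := ⟨1, one_pos, one_mem _⟩
  mul_mem' := by
    rintro g h ⟨m, hm, hg⟩ ⟨n, hn, hh⟩
    refine ⟨m * n, Nat.mul_pos hm hn, mul_mem ?_ ?_⟩
    · exact pow_mul x m n ▸ centralizer_le_centralizer_pow _ _ hg
    · exact pow_mul' x m n ▸ centralizer_le_centralizer_pow _ _ hh
  inv_mem' := fun ⟨n, hn, hg⟩ ↦ ⟨n, hn, inv_mem hg⟩

theorem mem_powCentralizer_iff {x g : G} :
    g ∈ powCentralizer x ↔ ∃ n, 0 < n ∧ Commute g (x ^ n) := by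
  simp only [commute_iff_eq, ← mem_centralizer_singleton_iff]
  rfl

theorem centralizer_pow_le_powCentralizer (x : G) {n : ℕ} (hn : 0 < n) :
    centralizer {x ^ n} ≤ powCentralizer x := fun _ hg ↦ ⟨n, hn, hg⟩

theorem powCentralizer_le_powCentralizer_pow (x : G) (n : ℕ) :
    powCentralizer x ≤ powCentralizer (x ^ n) := by
  simp only [SetLike.le_def, mem_powCentralizer_iff, pow_right_comm x n]
  exact fun g ⟨m, hm, hg⟩ ↦ ⟨m, hm, hg.pow_right n⟩

theorem powCentralizer_pow (x : G) {n : ℕ} (hn : 0 < n) :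
    powCentralizer (x ^ n) = powCentralizer x := by
  refine le_antisymm ?_ (powCentralizer_le_powCentralizer_pow x n)
  rintro g ⟨m, hm, hg⟩
  exact ⟨n * m, Nat.mul_pos hn hm, by rwa [pow_mul]⟩

theorem powCentralizer_inv (x : G) : powCentralizer x⁻¹ = powCentralizer x := by
  ext g
  simp only [mem_powCentralizer_iff, inv_pow, Commute.inv_right_iff]

theorem powCentralizer_inf_le_powCentralizer_mul {x y : G} (hxy : Commute x y) :
    powCentralizer x ⊓ powCentralizer y ≤ powCentralizer (x * y) := by
  rintro g ⟨hgx, hgy⟩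
  obtain ⟨m, hm, hgx⟩ := mem_powCentralizer_iff.mp hgx
  obtain ⟨n, hn, hgy⟩ := mem_powCentralizer_iff.mp hgy
  refine mem_powCentralizer_iff.mpr ⟨m * n, Nat.mul_pos hm hn, ?_⟩
  rw [hxy.mul_pow, pow_mul x, pow_mul' y]
  exact (hgx.pow_right n).mul_right (hgy.pow_right m)

theorem powCentralizer_mul_pow_le_inf {u c : G} (huc : Commute u c) {i j : ℕ} (hij : i < j)
    (hle : powCentralizer (u * c ^ i) ≤ powCentralizer (u * c ^ j)) :
    powCentralizer (u * c ^ i) ≤ powCentralizer u ⊓ powCentralizer c := by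
  have hcu (i : ℕ) : Commute u (c ^ i) := huc.pow_right i
  have hle_c : powCentralizer (u * c ^ i) ≤ powCentralizer c := by
    have hquot : (u * c ^ i)⁻¹ * (u * c ^ j) = c ^ (j - i) := by
      rw [← Nat.add_sub_cancel' hij.le, pow_add, Nat.add_sub_cancel_left]
      group
    have hcomm : Commute (u * c ^ i)⁻¹ (u * c ^ j) :=
      (((Commute.refl u).mul_left (hcu i).symm).mul_right
        ((hcu j).mul_left ((Commute.refl c).pow_pow i j))).inv_left
    calc powCentralizer (u * c ^ i)
        ≤ powCentralizer (u * c ^ i)⁻¹ ⊓ powCentralizer (u * c ^ j) :=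
          le_inf (powCentralizer_inv _).ge hle
      _ ≤ powCentralizer (c ^ (j - i)) :=
          hquot ▸ powCentralizer_inf_le_powCentralizer_mul hcomm
      _ = powCentralizer c := powCentralizer_pow c (Nat.sub_pos_of_lt hij)
  refine le_inf ?_ hle_c
  calc powCentralizer (u * c ^ i)
      ≤ powCentralizer (u * c ^ i) ⊓ powCentralizer (c ^ i)⁻¹ := by
        rw [powCentralizer_inv]
        exact le_inf le_rfl (hle_c.trans (powCentralizer_le_powCentralizer_pow c i))
    _ ≤ powCentralizer (u * c ^ i * (c ^ i)⁻¹) :=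
        powCentralizer_inf_le_powCentralizer_mul ((hcu i).mul_left (Commute.refl _)).inv_right
    _ = powCentralizer u := by rw [mul_inv_cancel_right]

theorem exists_powCentralizer_mul_pow_le_inf {u c : G} (huc : Commute u c)
    [(powCentralizer u).FiniteIndex] [(powCentralizer c).FiniteIndex] {I : Set ℕ}
    (hI : I.Infinite) :
    ∃ i ∈ I, powCentralizer (u * c ^ i) ≤ powCentralizer u ⊓ powCentralizer c := by
  have hge (i : ℕ) : powCentralizer u ⊓ powCentralizer c ≤ powCentralizer (u * c ^ i) :=
    (inf_le_inf_left _ (powCentralizer_le_powCentralizer_pow c i)).trans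
      (powCentralizer_inf_le_powCentralizer_mul (huc.pow_right i))
  obtain ⟨i, hi, j, -, hij, heq⟩ := hI.exists_lt_map_eq_of_mapsTo
    (fun i _ ↦ hge i) (finite_setOf_subgroup_ge (powCentralizer u ⊓ powCentralizer c))
  exact ⟨i, hi, powCentralizer_mul_pow_le_inf huc hij heq.le⟩

/-- Some positive power of `x` has only finitely many conjugates, i.e. is an FC-element. -/
def HasFCPower (x : G) : Prop :=
  ∃ n, 0 < n ∧ (centralizer {x ^ n}).FiniteIndex

theorem HasFCPower.finiteIndex_powCentralizer {x : G} (hx : HasFCPower x) :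
    (powCentralizer x).FiniteIndex := by
  obtain ⟨n, hn, _⟩ := hx
  exact Subgroup.finiteIndex_of_le (centralizer_pow_le_powCentralizer x hn)

theorem HasFCPower.exists_powCentralizer_eq {x : G} (hx : HasFCPower x) :
    ∃ n, 0 < n ∧ powCentralizer x = centralizer {x ^ n} := by
  obtain ⟨n, hn, _⟩ := hx
  obtain ⟨k, hk, hmax⟩ := Set.Finite.exists_maximalFor' (fun k ↦ centralizer {(x ^ n) ^ k})
    {k | 0 < k} ((finite_setOf_subgroup_ge (centralizer {x ^ n})).subset
      (by rintro _ ⟨k, -, rfl⟩; exact centralizer_le_centralizer_pow _ _)) ⟨1, one_pos⟩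
  refine ⟨n * k, Nat.mul_pos hn hk, le_antisymm ?_
    (centralizer_pow_le_powCentralizer x (Nat.mul_pos hn hk))⟩
  rintro g hg
  obtain ⟨m, hm, hgm⟩ : g ∈ powCentralizer (x ^ n) := (powCentralizer_pow x hn).ge hg
  rw [pow_mul]
  refine hmax (j := k * m) (Nat.mul_pos hk hm) ?_ ?_
  · simpa only [pow_mul] using centralizer_le_centralizer_pow ((x ^ n) ^ k) m
  · simpa only [pow_mul'] using centralizer_le_centralizer_pow ((x ^ n) ^ m) k hgm

theorem index_centralizer_singleton (x : G) :
    (centralizer {x}).index = (MulAction.orbit (ConjAct G) x).ncard := by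
  rw [← MulAction.index_stabilizer, Subgroup.centralizer_eq_comap_stabilizer]
  exact Subgroup.index_comap_of_surjective (G := ConjAct G) _ ConjAct.toConjAct.surjective

theorem encard_orbit_conjAct_le_iff {x : G} {m : ℕ} :
    (MulAction.orbit (ConjAct G) x).encard ≤ m ↔
      (centralizer {x}).FiniteIndex ∧ (centralizer {x}).index ≤ m := by
  rw [Set.encard_le_coe_iff_finite_ncard_le, Subgroup.finiteIndex_iff, index_centralizer_singleton]
  refine and_congr_left' ⟨fun hfin ↦ ?_, Set.finite_of_ncard_ne_zero⟩
  exact (Set.ncard_pos hfin).mpr (MulAction.nonempty_orbit x) |>.ne'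

end PowCentralizer

theorem exists_maximal_commuting_subset {M : Type*} [Mul M] (A : Set M) :
    ∃ s ⊆ A, (∀ a ∈ s, ∀ b ∈ s, Commute a b) ∧ ∀ x ∈ A, (∀ a ∈ s, Commute a x) → x ∈ s := by
  obtain ⟨s, ⟨hsA, hs⟩, hmax⟩ :=
    zorn_subset {s | s ⊆ A ∧ ∀ a ∈ s, ∀ b ∈ s, Commute a b} fun c hc hchain ↦ by
      refine ⟨⋃₀ c, ⟨Set.sUnion_subset fun s hs ↦ (hc hs).1, ?_⟩,
        fun s ↦ Set.subset_sUnion_of_mem⟩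
      rintro a ⟨s, hs, ha⟩ b ⟨t, ht, hb⟩
      rcases hchain.total hs ht with hst | hts
      · exact (hc ht).2 a (hst ha) b hb
      · exact (hc hs).2 a ha b (hts hb)
  refine ⟨s, hsA, hs, fun x hxA hx ↦ ?_⟩
  refine hmax (y := insert x s) ⟨Set.insert_subset hxA hsA, ?_⟩ (s.subset_insert x)
    (s.mem_insert x)
  rintro a (rfl | ha) b (rfl | hb)
  exacts [Commute.refl _, (hx b hb).symm, hx a ha, hs a ha b hb]

theorem lt_encard_range_iff {ι Y : Type*} {f : ι → Y} {m : ℕ} :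
    m < (Set.range f).encard ↔ ∃ t : Finset ι, m < t.card ∧ Set.InjOn f t := by
  constructor
  · intro h
    obtain ⟨r, hrf, hr⟩ := Set.exists_subset_encard_eq (Order.add_one_le_of_lt h)
    obtain ⟨t, rfl, ht⟩ := Set.exists_image_eq_injOn_of_subset_range hrf
    rw [ht.encard_image] at hr
    have htfin : t.Finite := Set.finite_of_encard_eq_coe (k := m + 1) (by exact_mod_cast hr)
    lift t to Finset ι using htfin
    have htcard : t.card = m + 1 := by
      rw [Set.encard_coe_eq_coe_finsetCard] at hr
      exact_mod_cast hr
    exact ⟨t, by omega, ht⟩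
  · rintro ⟨t, hmt, ht⟩
    calc (m : ℕ∞) < t.card := by exact_mod_cast hmt
      _ = (f '' t).encard := by rw [ht.encard_image, Set.encard_coe_eq_coe_finsetCard]
      _ ≤ (Set.range f).encard := Set.encard_le_encard (Set.image_subset_range f t)

theorem isOpen_setOf_injOn {ι X Y : Type*} [TopologicalSpace X] [TopologicalSpace Y] [T2Space Y]
    {f : ι → X → Y} (hf : ∀ i, Continuous (f i)) (t : Finset ι) :
    IsOpen {x | Set.InjOn (fun i ↦ f i x) t} := by
  have : {x | Set.InjOn (fun i ↦ f i x) t} =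
      ⋂ i ∈ t, ⋂ j ∈ t, ⋂ _ : i ≠ j, {x | f i x ≠ f j x} := by
    ext x
    simp [Set.injOn_iff_pairwise_ne, Set.Pairwise]
  rw [this]
  exact isOpen_biInter_finset fun i _ ↦ isOpen_biInter_finset fun j _ ↦
    isOpen_iInter_of_finite fun _ ↦ isOpen_ne_fun (hf i) (hf j)

theorem isClosed_setOf_encard_orbit_le {M X : Type*} [Monoid M] [MulAction M X]
    [TopologicalSpace X] [T2Space X] [ContinuousConstSMul M X] (m : ℕ) :
    IsClosed {x : X | (MulAction.orbit M x).encard ≤ m} := by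
  have : {x : X | (MulAction.orbit M x).encard ≤ m}ᶜ =
      ⋃ (t : Finset M) (_ : m < t.card), {x : X | Set.InjOn (fun g : M ↦ g • x) t} := by
    ext x
    simpa [MulAction.orbit] using lt_encard_range_iff (f := fun g : M ↦ g • x)
  rw [← isOpen_compl_iff, this]
  exact isOpen_biUnion fun t _ ↦ isOpen_setOf_injOn continuous_const_smul t

section CompactSubgroup

variable {G : Type*} [Group G] [TopologicalSpace G] [IsTopologicalGroup G]

theorem infinite_setOf_pow_mem [CompactSpace G] (x : G) {V : Set G} (hV : V ∈ 𝓝 1) :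
    {n : ℕ | x ^ n ∈ V}.Infinite :=
  Nat.frequently_atTop_iff_infinite.mp
    (mapClusterPt_iff_frequently.mp (mapClusterPt_one_atTop_pow x) V hV)

variable [T2Space G] {K : Subgroup G} [CompactSpace K]

theorem exists_isOpen_forall_index_powCentralizer_le (hK : ∀ x ∈ K, HasFCPower x) :
    ∃ U : Set K, IsOpen U ∧ U.Nonempty ∧ ∃ m, ∀ x ∈ U, (powCentralizer (x : G)).index ≤ m := by
  let E (p : ℕ × ℕ) : Set K := 
    {x | (MulAction.orbit (ConjAct G) ((x : G) ^ (p.1 + 1))).encard ≤ p.2}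
  have hclosed (p : ℕ × ℕ) : IsClosed (E p) :=
    (isClosed_setOf_encard_orbit_le p.2).preimage (by fun_prop)
  have hcover : ⋃ p, E p = Set.univ := by
    refine Set.eq_univ_of_forall fun x ↦ ?_
    obtain ⟨n, hn, hfin⟩ := hK x x.2
    obtain ⟨n, rfl⟩ := Nat.exists_eq_add_one.mpr hn
    exact Set.mem_iUnion.mpr ⟨(n, (centralizer {(x : G) ^ (n + 1)}).index),
      encard_orbit_conjAct_le_iff.mpr ⟨hfin, le_rfl⟩⟩
  obtain ⟨⟨n, m⟩, hne⟩ := nonempty_interior_of_iUnion_of_closed hclosed hcover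
  refine ⟨interior (E (n, m)), isOpen_interior, hne, m, fun x hx ↦ ?_⟩
  obtain ⟨_, hindex⟩ := encard_orbit_conjAct_le_iff.mp (show x ∈ E (n, m) from interior_subset hx)
  exact (Subgroup.index_antitone (centralizer_pow_le_powCentralizer _ n.succ_pos)).trans hindex

theorem exists_forall_commute_powCentralizer_le (hK : ∀ x ∈ K, HasFCPower x) :
    ∃ u ∈ K, ∀ c ∈ K, Commute u c → powCentralizer u ≤ powCentralizer c := by
  obtain ⟨U, hUo, hUne, m, hUm⟩ := exists_isOpen_forall_index_powCentralizer_le hK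
  obtain ⟨u, huU, hmax⟩ := Set.Finite.exists_maximalFor'
    (fun x : K ↦ (powCentralizer (x : G)).index) U
    ((Set.finite_Iic m).subset (by rintro _ ⟨x, hx, rfl⟩; exact hUm x hx)) hUne
  refine ⟨u, u.2, fun c hc huc ↦ ?_⟩
  have := (hK u u.2).finiteIndex_powCentralizer
  have := (hK c hc).finiteIndex_powCentralizer
  have hU : (u * ·) ⁻¹' U ∈ 𝓝 (1 : K) :=
    (hUo.preimage (by fun_prop)).mem_nhds (by simpa using huU)
  obtain ⟨v, hvU, hv⟩ :
      ∃ v ∈ U, powCentralizer (v : G) ≤ powCentralizer (u : G) ⊓ powCentralizer c := by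
    obtain ⟨i, hiU, hi⟩ :=
      exists_powCentralizer_mul_pow_le_inf huc (infinite_setOf_pow_mem (⟨c, hc⟩ : K) hU)
    exact ⟨u * ⟨c, hc⟩ ^ i, hiU, by simpa only [Subgroup.coe_mul, Subgroup.coe_pow] using hi⟩
  have := (hK v v.2).finiteIndex_powCentralizer
  have heq : powCentralizer (v : G) = powCentralizer (u : G) := by
    refine (hv.trans inf_le_left).eq_of_not_lt fun hlt ↦ ?_
    have hindex := Subgroup.index_strictAnti hlt
    exact hindex.not_ge (hmax hvU hindex.le)
  exact heq.ge.trans (hv.trans inf_le_right)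

theorem exists_forall_powCentralizer_le (hK : ∀ x ∈ K, HasFCPower x) :
    ∃ u ∈ K, ∀ x ∈ K, powCentralizer u ≤ powCentralizer x := by
  obtain ⟨s, hsK, hcomm, hmax⟩ :=
    exists_maximal_commuting_subset {c | c ∈ K ∧ powCentralizer c = centralizer {c}}
  have : CompactSpace (K ⊓ centralizer s : Subgroup G) := isCompact_iff_compactSpace.mp
    ((isCompact_iff_compactSpace.mpr ‹_›).inter_right (Set.isClosed_centralizer s))
  obtain ⟨u, ⟨huK, hus⟩, hu⟩ :=
    exists_forall_commute_powCentralizer_le fun x (hx : x ∈ K ⊓ centralizer s) ↦ hK x hx.1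
  have hu_le (c : G) (hc : c ∈ s) : powCentralizer u ≤ centralizer {c} :=
    (hu c ⟨(hsK hc).1, fun a ha ↦ hcomm a ha c hc⟩ (hus c hc).symm).trans (hsK hc).2.le
  refine ⟨u, huK, fun x hx ↦ ?_⟩
  obtain ⟨k, hk, hxk⟩ := (hK x hx).exists_powCentralizer_eq
  obtain ⟨n, hn, -, hnu⟩ := Subgroup.exists_pow_mem_of_index_ne_zero
    (hK u huK).finiteIndex_powCentralizer.index_ne_zero (x ^ k)
  have hpow : powCentralizer ((x ^ k) ^ n) = powCentralizer x := by
    rw [powCentralizer_pow _ hn, powCentralizer_pow _ hk]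
  have hstable : powCentralizer ((x ^ k) ^ n) = centralizer {(x ^ k) ^ n} := by
    refine le_antisymm ?_ ?_
    · exact (hpow.trans hxk).le.trans (centralizer_le_centralizer_pow _ n)
    · exact (centralizer_pow_le_powCentralizer _ hn).trans (powCentralizer_pow _ hn).ge
  have hmem : (x ^ k) ^ n ∈ s := hmax _ ⟨pow_mem (pow_mem hx k) n, hstable⟩ fun c hc ↦
    (mem_centralizer_singleton_iff.mp (hu_le c hc hnu)).symm
  exact (hu_le _ hmem).trans (hstable.symm.trans hpow).le

theorem exists_isOpen_normal_forall_pow_mem_centralizer (hK : ∀ x ∈ K, HasFCPower x) :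
    ∃ T : Subgroup G, T.Normal ∧ IsOpen (T : Set G) ∧
      ∀ x ∈ K, ∃ n, 0 < n ∧ x ^ n ∈ centralizer (T : Set G) := by
  obtain ⟨u, huK, hu⟩ := exists_forall_powCentralizer_le hK
  have := (hK u huK).finiteIndex_powCentralizer
  have hclosed : IsClosed (powCentralizer u : Set G) := by
    obtain ⟨n, -, hn⟩ := (hK u huK).exists_powCentralizer_eq
    exact hn ▸ Set.isClosed_centralizer _
  refine ⟨(powCentralizer u).normalCore, inferInstance,
    Subgroup.isOpen_of_isClosed_of_finiteIndex _ (Subgroup.normalCore_isClosed _ hclosed),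
    fun x hx ↦ ?_⟩
  obtain ⟨n, hn, hxn⟩ := (hK x hx).exists_powCentralizer_eq
  have hle : (powCentralizer u).normalCore ≤ centralizer {x ^ n} :=
    ((powCentralizer u).normalCore_le.trans (hu x hx)).trans hxn.le
  exact ⟨n, hn, fun g hg ↦ mem_centralizer_singleton_iff.mp (hle hg)⟩

end CompactSubgroup

section CommutingProbability

variable {G : Type*} [Group G] [TopologicalSpace G] [IsTopologicalGroup G]

theorem finiteIndex_of_denseRange_zpow {x : G} (hx : DenseRange fun k : ℤ ↦ x ^ k)
    {P : Subgroup G} (hP : IsClosed (P : Set G)) {n : ℕ} (hn : 0 < n) (hxn : x ^ n ∈ P) :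
    P.FiniteIndex := by
  let f : ℤ → G ⧸ P := fun k ↦ (x ^ k : G)
  have hper : Periodic f n := fun k ↦ by
    simpa [f, QuotientGroup.eq, zpow_add] using hxn
  have hfin : (Set.range f).Finite := by
    rw [← hper.image_Ioc (by exact_mod_cast hn) 0]
    exact (Set.finite_Ioc _ _).image f
  have hdense : DenseRange f :=
    QuotientGroup.mk_surjective.denseRange.comp hx QuotientGroup.continuous_mk
  have huniv : Set.range f = Set.univ := by
    rw [← hfin.isClosed.closure_eq, hdense.closure_range]
  have : Finite (G ⧸ P) := Set.finite_univ_iff.mp (huniv ▸ hfin)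
  exact Subgroup.finiteIndex_of_finite_quotient

variable [CompactSpace G]

theorem finiteIndex_of_isOpen {S : Subgroup G} (hS : IsOpen (S : Set G)) : S.FiniteIndex :=
  have := S.quotient_finite_of_isOpen hS
  Subgroup.finiteIndex_of_finite_quotient

theorem isOpen_of_normalizedHaar_pos {S : Subgroup G} (hS : IsClosed (S : Set G))
    (hpos : 0 < normalizedHaar G S) : IsOpen (S : Set G) := by
  borelize G
  refine S.isOpen_of_mem_nhds (g := 1) (mem_of_superset
    (Measure.div_mem_nhds_one_of_haar_pos (Measure.haarMeasure ⊤) _ hS.measurableSet hpos) ?_)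
  rintro _ ⟨a, ha, b, hb, rfl⟩
  exact S.div_mem ha hb

theorem eventually_normalizedHaar_smul_inter_pos {E : Set G} (hE : IsClosed E)
    (hpos : 0 < normalizedHaar G E) : ∀ᶠ g in 𝓝 (1 : G), 0 < normalizedHaar G (g • E ∩ E) := by
  borelize G
  let μ : Measure G := Measure.haarMeasure ⊤
  filter_upwards [eventually_nhds_one_measure_smul_sdiff_lt (μ := μ) hE.isCompact hE hpos.ne']
    with g hg
  refine pos_iff_ne_zero.mpr fun (hzero : μ (g • E ∩ E) = 0) ↦ hg.not_ge ?_
  calc μ E = μ (g • E) := (measure_smul μ g E).symm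
    _ ≤ μ (g • E ∩ E) + μ (g • E \ E) := measure_le_inter_add_sdiff _ _ _
    _ = μ (g • E \ E) := by rw [hzero, zero_add]

theorem commutingPr_pos_of_mem_nhds {H : Subgroup G} [CompactSpace H] {U : Set H} {V : Set G}
    {a : H} {b : G} (hU : U ∈ 𝓝 a) (hV : V ∈ 𝓝 b) (hUV : ∀ h ∈ U, ∀ g ∈ V, Commute (h : G) g) :
    0 < commutingPr H := by
  borelize (H × G)
  let μ : Measure (H × G) := Measure.haarMeasure ⊤
  calc 0 < μ (U ×ˢ V) := μ.measure_pos_of_mem_nhds (prod_mem_nhds hU hV)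
    _ ≤ commutingPr H := measure_mono fun p hp ↦ hUV p.1 hp.1 p.2 hp.2

variable [T2Space G]

theorem eventually_isOpen_centralizer {H : Subgroup G} [CompactSpace H] (hpos : 0 < commutingPr H) :
    ∀ᶠ h : H in 𝓝 1, IsOpen (centralizer {(h : G)} : Set G) := by
  let E : Set (H × G) := {p | (p.1 : G) * p.2 = p.2 * (p.1 : G)}
  have hE : IsClosed E := isClosed_eq (by fun_prop) (by fun_prop)
  have hcont : ContinuousAt (fun h : H ↦ (h, (1 : G))) 1 := by fun_prop
  filter_upwards [hcont.eventually (eventually_normalizedHaar_smul_inter_pos hE hpos)] with h hh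
  let C : Subgroup (H × G) := (⊤ : Subgroup H).prod (centralizer {(h : G)})
  have hsub : (h, (1 : G)) • E ∩ E ⊆ C := by
    rintro _ ⟨⟨⟨a, g⟩, hag : Commute (a : G) g, rfl⟩, hhag⟩
    have hhag : Commute ((h : G) * a) g := by simpa [E, commute_iff_eq] using hhag
    have hcomm : Commute (h : G) g := by simpa using hhag.mul_left hag.inv_left
    simpa [C, Subgroup.mem_prod, mem_centralizer_singleton_iff] using hcomm.eq.symm
  have hC : IsClosed (C : Set (H × G)) :=
    isClosed_univ.prod (Set.isClosed_centralizer _)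
  have hCo : IsOpen (C : Set (H × G)) :=
    isOpen_of_normalizedHaar_pos hC (hh.trans_le (measure_mono hsub))
  simpa [C, Subgroup.coe_prod] using hCo.preimage (Continuous.prodMk_right (1 : H))

theorem commutingPr_monothetic_pos_iff {x : G} :
    0 < commutingPr (monothetic x) ↔ HasFCPower x := by
  let y : monothetic x := ⟨x, Subgroup.le_topologicalClosure _ (Subgroup.mem_zpowers x)⟩
  constructor
  · intro hpos
    obtain ⟨n, hn : IsOpen _, hn0⟩ :=
      (infinite_setOf_pow_mem y (eventually_isOpen_centralizer hpos)).exists_gt 0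
    exact ⟨n, hn0, finiteIndex_of_isOpen hn⟩
  · rintro ⟨n, hn, _⟩
    let C := centralizer {x ^ n}
    let P := (centralizer (C : Set G)).subgroupOf (monothetic x)
    have hC : IsOpen (C : Set G) :=
      C.isOpen_of_isClosed_of_finiteIndex (Set.isClosed_centralizer _)
    have hP : IsClosed (P : Set (monothetic x)) :=
      (Set.isClosed_centralizer _).preimage continuous_subtype_val
    have hy : DenseRange fun k : ℤ ↦ y ^ k := by
      rw [DenseRange, Subtype.dense_iff, ← Set.range_comp]
      exact subset_rfl
    have hyP : y ^ n ∈ P := fun g hg ↦ mem_centralizer_singleton_iff.mp hg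
    have := finiteIndex_of_denseRange_zpow hy hP hn hyP
    have hPo : IsOpen (P : Set (monothetic x)) := P.isOpen_of_isClosed_of_finiteIndex hP
    exact commutingPr_pos_of_mem_nhds (hPo.mem_nhds (one_mem P)) (hC.mem_nhds (one_mem C))
      fun h hh g hg ↦ (hh g hg).symm

end CommutingProbability

theorem isMulTorsion_quotient_iff {G : Type*} [Group G] {N : Subgroup G} [N.Normal] :
    IsMulTorsion (G ⧸ N) ↔ ∀ x : G, ∃ n, 0 < n ∧ x ^ n ∈ N := by
  simp only [IsMulTorsion, QuotientGroup.mk_surjective.forall, isOfFinOrder_iff_pow_eq_one,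
    ← QuotientGroup.mk_pow, QuotientGroup.eq_one_iff]

theorem isMulTorsion_quotient_centralizerIn_iff {G : Type*} [Group G] {K T : Subgroup G}
    [T.Normal] : IsMulTorsion (K ⧸ centralizerIn K T) ↔
      ∀ x ∈ K, ∃ n, 0 < n ∧ x ^ n ∈ centralizer (T : Set G) := by
  rw [isMulTorsion_quotient_iff]
  simp [centralizerIn, Subgroup.mem_subgroupOf]

theorem mem_centerOf_iff {G : Type*} [Group G] {T : Subgroup G} {x : G} :
    x ∈ centerOf T ↔ x ∈ T ∧ x ∈ centralizer (T : Set G) := by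
  simp [centerOf, Subgroup.mem_center_iff, mem_centralizer_iff, Subtype.ext_iff, and_comm]

variable {G : Type*} [Group G] [TopologicalSpace G] [IsTopologicalGroup G] [CompactSpace G]

theorem isVirtuallyCentralByTorsion_iff :
    IsVirtuallyCentralByTorsion G ↔ ∃ (T : Subgroup G) (_ : T.Normal), IsOpen (T : Set G) ∧
      IsMulTorsion ((⊤ : Subgroup G) ⧸ centralizerIn ⊤ T) := by
  refine exists_congr fun T ↦ exists_congr fun _ ↦ and_congr_right fun hT ↦ ?_
  rw [isMulTorsion_quotient_centralizerIn_iff, isMulTorsion_quotient_iff]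
  simp only [mem_centerOf_iff, Subgroup.mem_top, forall_const]
  refine forall_congr' fun x ↦ ⟨fun ⟨n, hn, h⟩ ↦ ⟨n, hn, h.2⟩, fun ⟨n, hn, h⟩ ↦ ?_⟩
  obtain ⟨k, hk, -, hkT⟩ := Subgroup.exists_pow_mem_of_index_ne_zero
    (finiteIndex_of_isOpen hT).index_ne_zero (x ^ n)
  exact ⟨n * k, Nat.mul_pos hn hk, by rw [pow_mul]; exact ⟨hkT, pow_mem h k⟩⟩

theorem forall_commutingPr_pos_iff [T2Space G] {K : Subgroup G} (hK : IsClosed (K : Set G)) :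
    (∀ x ∈ K, 0 < commutingPr (monothetic x)) ↔
      ∃ (T : Subgroup G) (_ : T.Normal), IsOpen (T : Set G) ∧
        IsMulTorsion (K ⧸ centralizerIn K T) := by
  have : CompactSpace K := isCompact_iff_compactSpace.mp hK.isCompact
  simp only [commutingPr_monothetic_pos_iff]
  constructor
  · intro h
    obtain ⟨T, hT, hTo, hTK⟩ := exists_isOpen_normal_forall_pow_mem_centralizer h
    exact ⟨T, hT, hTo, isMulTorsion_quotient_centralizerIn_iff.mpr hTK⟩
  · rintro ⟨T, hT, hTo, htor⟩ x hx
    obtain ⟨n, hn, hxn⟩ := isMulTorsion_quotient_centralizerIn_iff.mp htor x hx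
    have hle : T ≤ centralizer {x ^ n} := fun g hg ↦ mem_centralizer_singleton_iff.mpr (hxn g hg)
    exact ⟨n, hn, finiteIndex_of_isOpen (Subgroup.isOpen_mono hle hTo)⟩

end CompactGroupPr

theorem theorem1p1 (G : Type*) [Group G] [TopologicalSpace G] [IsTopologicalGroup G]
    [CompactSpace G] [T2Space G] :
    (∀ K : Subgroup G, IsClosed (K : Set G) →
      ((∀ x ∈ K, 0 < CompactGroupPr.commutingPr (CompactGroupPr.monothetic x)) ↔
        ∃ (T : Subgroup G) (_ : T.Normal), IsOpen (T : Set G) ∧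
          IsMulTorsion (K ⧸ CompactGroupPr.centralizerIn K T))) ∧
    ((∀ x : G, 0 < CompactGroupPr.commutingPr (CompactGroupPr.monothetic x)) ↔
      CompactGroupPr.IsVirtuallyCentralByTorsion G) := by
  refine ⟨fun K hK => CompactGroupPr.forall_commutingPr_pos_iff hK, ?_⟩
  rw [CompactGroupPr.isVirtuallyCentralByTorsion_iff,
    ← CompactGroupPr.forall_commutingPr_pos_iff (K := ⊤) isClosed_univ]
  simp
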